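/- Identify a finite sequence $(f_0,\dots,f_{k-1})$ of complex numbers with the polynomial $f(z)=\sum_j f_jz^j$, where $f_j=0$ for every integer $j\notin\{0,\dots,k-1\}$. For two sequences $f,g$ and $s\in\mathbb Z$ let $C_{f,g}(s)=\sum_{j\in\mathbb Z}f_{j+s}\overline{g_j}$ be the aperiodic crosscorrelation, and let $\mathrm{PCC}(f,g)=\max_{s\in\mathbb Z}|C_{f,g}(s)|$ be the peak crosscorrelation. The Rudin–Shapiro sequences $x_n$ and their companions $y_n$ are defined by $x_0=y_0=1$ and, for $n\ge 0$, $$x_{n+1}(z)=x_n(z)+z^{2^n}y_n(z),\qquad y_{n+1}(z)=x_n(z)-z^{2^n}y_n(z).$$ **Theorem.** The polynomial $X^3+X^2-2X-4$ has a unique real root $\alpha_0=1.658967\ldots$. For every integer $n\ge 0$, $$\mathrm{PCC}(x_n,y_n)\le 5\,\alpha_0^{\,n-3}=(1.095107\ldots)\,\alpha_0^{\,n},$$ with equality if and only if $n=3$, and $$\mathrm{PCC}(x_n,y_n)\ \ge\ \left[\frac{9\alpha_0^2+4\alpha_0+6}{59}-2\sqrt{\frac{-4\alpha_0^2+2\alpha_0+14}{59}}\left(\sqrt{\frac{\alpha_0^2-1}{2}}\right)^{n}\right]\alpha_0^{\,n},$$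 where $\frac{9\alpha_0^2+4\alpha_0+6}{59}=0.633990\ldots$, $2\sqrt{\frac{-4\alpha_0^2+2\alpha_0+14}{59}}=0.654022\ldots$ and $\sqrt{\frac{\alpha_0^2-1}{2}}=0.935994\ldots$. -/

import Mathlib

open Polynomial

noncomputable section

/-- A sequence `(f_0, …, f_{k-1})` of complex numbers is identified with the polynomial
`∑ j, f_j z^j`; its `j`-th term is defined for every integer `j`, and is `0` when `j` is negative
or beyond the degree. -/
def seqTerm (f : ℂ[X]) (j : ℤ) : ℂ :=
  if 0 ≤ j then f.coeff j.toNat else 0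

/-- The aperiodic crosscorrelation of `f` with `g` at shift `s`, that is,
`∑_{j ∈ ℤ} f_{j+s} * conj g_j`, a sum with finitely many nonzero terms. -/
def crosscorrelation (f g : ℂ[X]) (s : ℤ) : ℂ :=
  ∑ᶠ j : ℤ, seqTerm f (j + s) * starRingEnd ℂ (seqTerm g j)

/-- The peak crosscorrelation of `f` and `g`: the maximum of `|C_{f,g}(s)|` over `s ∈ ℤ`.
The supremum is always attained, as `isGreatest_peakCrosscorrelation` shows. -/
def peakCrosscorrelation (f g : ℂ[X]) : ℝ :=
  ⨆ s : ℤ, ‖crosscorrelation f g s‖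

/-- The pairs `(x_n, y_n)` obtained from the length `ℓ₀` and the seed pair `(x₀, y₀)` via the
Golay--Rudin--Shapiro recursion
`x_{n+1} = x_n + z^(2^n ℓ₀) y_n` and `y_{n+1} = x_n - z^(2^n ℓ₀) y_n`. -/
def golayRudinShapiro (l₀ : ℕ) (x₀ y₀ : ℂ[X]) : ℕ → ℂ[X] × ℂ[X]
  | 0 => (x₀, y₀)
  | n + 1 =>
    let p := golayRudinShapiro l₀ x₀ y₀ n
    (p.1 + X ^ (2 ^ n * l₀) * p.2, p.1 - X ^ (2 ^ n * l₀) * p.2)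

/-- The `n`-th Rudin--Shapiro sequence. -/
def rudinShapiro (n : ℕ) : ℂ[X] := (golayRudinShapiro 1 1 1 n).1

/-- The `n`-th Rudin--Shapiro companion sequence. -/
def rudinShapiroCompanion (n : ℕ) : ℂ[X] := (golayRudinShapiro 1 1 1 n).2

theorem seqTerm_eq_zero {f : ℂ[X]} {j : ℤ} (h : j < 0 ∨ (f.natDegree : ℤ) < j) :
    seqTerm f j = 0 := by
  unfold seqTerm
  split_ifs with h0
  · exact Polynomial.coeff_eq_zero_of_natDegree_lt (by omega)
  · rfl

theorem crosscorrelation_eq_zero {f g : ℂ[X]} {s : ℤ}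
    (h : s < -(g.natDegree : ℤ) ∨ (f.natDegree : ℤ) < s) : crosscorrelation f g s = 0 := by
  unfold crosscorrelation
  rw [← finsum_zero (α := ℤ)]
  congr 1
  funext j
  by_cases hj : j < 0 ∨ (g.natDegree : ℤ) < j
  · simp [seqTerm_eq_zero hj]
  · rw [seqTerm_eq_zero (f := f) (j := j + s) (by omega), zero_mul]

/-- The peak crosscorrelation is a true maximum. -/
theorem isGreatest_peakCrosscorrelation (f g : ℂ[X]) :
    IsGreatest (Set.range fun s : ℤ => ‖crosscorrelation f g s‖) (peakCrosscorrelation f g) := by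
  have hfin : (Set.range fun s : ℤ => ‖crosscorrelation f g s‖).Finite := by
    refine (((Set.finite_Icc (-(g.natDegree : ℤ)) (f.natDegree : ℤ)).image
      fun s : ℤ => ‖crosscorrelation f g s‖).union (Set.finite_singleton (0 : ℝ))).subset ?_
    rintro _ ⟨s, rfl⟩
    by_cases hs : s < -(g.natDegree : ℤ) ∨ (f.natDegree : ℤ) < s
    · right
      simp [crosscorrelation_eq_zero hs]
    · left
      exact ⟨s, ⟨by omega, by omega⟩, rfl⟩
  exact ⟨(Set.range_nonempty _).csSup_mem hfin, fun _ hy => le_csSup hfin.bddAbove hy⟩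

end

/-! Write C for the crosscorrelation of the pair and D for the difference of its autocorrelations.
The recursion expresses C and D at level n+1 through C and D at level n, and D(s) = C(s) - C(-s) for
s ≥ 0 (`rsCorrelation_snd`), so C closes up on itself. Grouping the values at ±t and ±(2^n - t),
each triple at level n+1 arises from one at level n by one of two linear maps, `fold` and `flip`.
The peak is thus the largest coordinate among all products of n such maps applied to (1, 1, 0).

The growth rate is α because -α is an eigenvalue of `flip`, and a suitable polytope norm expands by
at most α under both maps (`PeakBound.fold`, `PeakBound.flip`). Entering the polytope at level 4
gives the bound 1.07 α^n, below 5 α^(n-3); lower levels are listed by hand.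

For the lower bound only `flip` is applied. Up to sign, the second coordinate is c α^n plus the
contribution of the conjugate pair of roots of the cubic, which a quadratic form scaling
geometrically along the orbit (`flipDeviation_form`) keeps small. -/

/-! ### Crosscorrelation as a sesquilinear form -/

theorem seqTerm_add (f g : ℂ[X]) (j : ℤ) : seqTerm (f + g) j = seqTerm f j + seqTerm g j := by
  unfold seqTerm
  split_ifs <;> simp

theorem seqTerm_neg (f : ℂ[X]) (j : ℤ) : seqTerm (-f) j = -seqTerm f j := by
  unfold seqTerm
  split_ifs <;> simp

theorem seqTerm_X_pow_mul (k : ℕ) (f : ℂ[X]) (j : ℤ) :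
    seqTerm (X ^ k * f) j = seqTerm f (j - k) := by
  unfold seqTerm
  rw [coeff_X_pow_mul']
  split_ifs with h₁ h₂ h₃ h₃ h₃
  · congr 1
    omega
  all_goals first | rfl | omega

theorem finite_support_crosscorrelation (f g : ℂ[X]) (s : ℤ) :
    (Function.support fun j : ℤ => seqTerm f (j + s) * starRingEnd ℂ (seqTerm g j)).Finite := by
  refine (Set.finite_Icc (0 : ℤ) g.natDegree).subset fun j hj => ?_
  by_contra h
  refine hj ?_
  have : j < 0 ∨ (g.natDegree : ℤ) < j := by
    simp only [Set.mem_Icc] at h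
    omega
  simp [seqTerm_eq_zero this]

theorem crosscorrelation_add_left (f g h : ℂ[X]) (s : ℤ) :
    crosscorrelation (f + g) h s = crosscorrelation f h s + crosscorrelation g h s := by
  unfold crosscorrelation
  rw [← finsum_add_distrib (finite_support_crosscorrelation f h s)
    (finite_support_crosscorrelation g h s)]
  simp only [seqTerm_add, add_mul]

theorem crosscorrelation_add_right (f g h : ℂ[X]) (s : ℤ) :
    crosscorrelation f (g + h) s = crosscorrelation f g s + crosscorrelation f h s := by
  unfold crosscorrelation
  rw [← finsum_add_distrib (finite_support_crosscorrelation f g s)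
    (finite_support_crosscorrelation f h s)]
  simp only [seqTerm_add, map_add, mul_add]

theorem crosscorrelation_neg_left (f g : ℂ[X]) (s : ℤ) :
    crosscorrelation (-f) g s = -crosscorrelation f g s := by
  unfold crosscorrelation
  rw [← finsum_neg_distrib]
  simp only [seqTerm_neg, neg_mul]

theorem crosscorrelation_neg_right (f g : ℂ[X]) (s : ℤ) :
    crosscorrelation f (-g) s = -crosscorrelation f g s := by
  unfold crosscorrelation
  rw [← finsum_neg_distrib]
  simp only [seqTerm_neg, map_neg, mul_neg]

theorem crosscorrelation_X_pow_mul_left (k : ℕ) (f g : ℂ[X]) (s : ℤ) :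
    crosscorrelation (X ^ k * f) g s = crosscorrelation f g (s - k) := by
  unfold crosscorrelation
  simp only [seqTerm_X_pow_mul, add_sub_assoc]

theorem crosscorrelation_X_pow_mul_right (k : ℕ) (f g : ℂ[X]) (s : ℤ) :
    crosscorrelation f (X ^ k * g) s = crosscorrelation f g (s + k) := by
  unfold crosscorrelation
  rw [← finsum_comp_equiv (Equiv.addRight (k : ℤ))]
  refine finsum_congr fun j => ?_
  rw [seqTerm_X_pow_mul, Equiv.coe_addRight, add_sub_cancel_right]
  congr 2
  ring

theorem crosscorrelation_swap (f g : ℂ[X]) (s : ℤ) :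
    crosscorrelation g f s = starRingEnd ℂ (crosscorrelation f g (-s)) := by
  unfold crosscorrelation
  rw [show ∀ z, starRingEnd ℂ z = (starRingEnd ℂ).toAddMonoidHom z from fun _ => rfl,
    (starRingEnd ℂ).toAddMonoidHom.map_finsum (finite_support_crosscorrelation f g (-s)),
    ← finsum_comp_equiv (Equiv.addRight (-s))]
  refine finsum_congr fun j => ?_
  simp [mul_comm]

/-! ### Correlations of the Rudin--Shapiro pairs -/

/-- The real sequences `s ↦ (C_{x,y}(s), C_{x,x}(s) - C_{y,y}(s))` for `x = x_n`, `y = y_n`,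
given by their recursion. -/
def rsCorrelation : ℕ → ℤ → ℝ × ℝ
  | 0, s => (if s = 0 then 1 else 0, 0)
  | n + 1, s =>
    ((rsCorrelation n s).2 + (rsCorrelation n (2 ^ n - s)).1 - (rsCorrelation n (2 ^ n + s)).1,
      2 * ((rsCorrelation n (2 ^ n - s)).1 + (rsCorrelation n (2 ^ n + s)).1))

theorem crosscorrelation_one_one (s : ℤ) :
    crosscorrelation 1 1 s = if s = 0 then 1 else 0 := by
  unfold crosscorrelation
  rw [finsum_eq_single _ 0 fun j hj => ?_]
  · rw [zero_add]
    unfold seqTerm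
    simp only [coeff_one]
    split_ifs <;> first | omega | simp
  · have : j < 0 ∨ ((1 : ℂ[X]).natDegree : ℤ) < j := by
      rw [natDegree_one]
      omega
    simp [seqTerm_eq_zero this]

theorem rudinShapiro_succ (n : ℕ) :
    rudinShapiro (n + 1) = rudinShapiro n + X ^ 2 ^ n * rudinShapiroCompanion n := by
  simp [rudinShapiro, rudinShapiroCompanion, golayRudinShapiro]

theorem rudinShapiroCompanion_succ (n : ℕ) :
    rudinShapiroCompanion (n + 1) = rudinShapiro n + -(X ^ 2 ^ n * rudinShapiroCompanion n) := by
  simp [rudinShapiro, rudinShapiroCompanion, golayRudinShapiro, sub_eq_add_neg]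

theorem crosscorrelation_rudinShapiro_aux (n : ℕ) : ∀ s : ℤ,
    crosscorrelation (rudinShapiro n) (rudinShapiroCompanion n) s = (rsCorrelation n s).1 ∧
    crosscorrelation (rudinShapiro n) (rudinShapiro n) s
      - crosscorrelation (rudinShapiroCompanion n) (rudinShapiroCompanion n) s
      = (rsCorrelation n s).2 := by
  induction n with
  | zero =>
    intro s
    simp only [rudinShapiro, rudinShapiroCompanion, golayRudinShapiro, rsCorrelation,
      crosscorrelation_one_one, sub_self, Complex.ofReal_zero, and_true]
    split_ifs <;> simp
  | succ n ih =>
    intro s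
    have hswap : crosscorrelation (rudinShapiroCompanion n) (rudinShapiro n) (s - 2 ^ n)
        = (rsCorrelation n (2 ^ n - s)).1 := by
      rw [crosscorrelation_swap, (ih _).1, Complex.conj_ofReal, neg_sub]
    have hshift := (ih (2 ^ n + s)).1
    have hdiff := (ih s).2
    simp only [rudinShapiro_succ, rudinShapiroCompanion_succ, crosscorrelation_add_left,
      crosscorrelation_add_right, crosscorrelation_neg_left, crosscorrelation_neg_right,
      crosscorrelation_X_pow_mul_left, crosscorrelation_X_pow_mul_right, Nat.cast_pow,
      Nat.cast_ofNat, rsCorrelation, add_sub_cancel_right, add_sub_assoc]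
    push_cast
    rw [hswap, add_comm s, hshift, ← hdiff]
    constructor <;> ring

theorem crosscorrelation_rudinShapiro (n : ℕ) (s : ℤ) :
    crosscorrelation (rudinShapiro n) (rudinShapiroCompanion n) s = (rsCorrelation n s).1 :=
  (crosscorrelation_rudinShapiro_aux n s).1

theorem rsCorrelation_eq_zero (n : ℕ) : ∀ s : ℤ, 2 ^ n ≤ |s| → rsCorrelation n s = (0, 0) := by
  induction n with
  | zero =>
    intro s hs
    have : s ≠ 0 := by
      rintro rfl
      simp at hs
    simp [rsCorrelation, this]
  | succ n ih =>
    intro s hs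
    have hpos : (0 : ℤ) < 2 ^ n := by positivity
    rw [pow_succ, le_abs] at hs
    simp only [rsCorrelation]
    rw [ih s (by rw [le_abs]; omega), ih (2 ^ n - s) (by rw [le_abs]; omega),
      ih (2 ^ n + s) (by rw [le_abs]; omega)]
    simp

theorem rsCorrelation_snd_neg (n : ℕ) (s : ℤ) :
    (rsCorrelation n (-s)).2 = (rsCorrelation n s).2 := by
  cases n with
  | zero => simp [rsCorrelation]
  | succ n =>
    simp only [rsCorrelation, sub_neg_eq_add, ← sub_eq_add_neg]
    ring

/-- Subtracting the recursion at s and -s cancels the even part D and doubles the C(2^n - s) term;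
the term at 2^n + s lies outside the support. -/
theorem rsCorrelation_snd (n : ℕ) (s : ℤ) (hs : 0 ≤ s) :
    (rsCorrelation n s).2 = (rsCorrelation n s).1 - (rsCorrelation n (-s)).1 := by
  cases n with
  | zero => simp [rsCorrelation]
  | succ n =>
    have hzero := rsCorrelation_eq_zero n (2 ^ n + s) (by rw [le_abs]; omega)
    simp only [rsCorrelation, rsCorrelation_snd_neg, sub_neg_eq_add, ← sub_eq_add_neg, hzero]
    ring

/-- The triples `(C(t), C(-t), C(2^n - t))` for `0 ≤ t ≤ 2^(n-1)`, where `C` is the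
crosscorrelation of `x_n` with `y_n`. -/
inductive RSTriple : ℕ → ℝ → ℝ → ℝ → Prop
  | zero : RSTriple 0 1 1 0
  | fold {n : ℕ} {p q r : ℝ} : RSTriple n p q r → RSTriple (n + 1) (p - q + r) (p - q - r) (-r)
  | flip {n : ℕ} {p q r : ℝ} : RSTriple n p q r → RSTriple (n + 1) (p + 2 * r) (2 * r - p) q

/-- The values of the crosscorrelation at `±t` and `±(2^n - t)` are `p`, `q` and `±r`. -/
structure IsRSTripleAt (n : ℕ) (t : ℤ) (p q r : ℝ) : Prop where
  nonneg : 0 ≤ t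
  le : 2 * t ≤ 2 ^ n
  pos_eq : (rsCorrelation n t).1 = p
  neg_eq : (rsCorrelation n (-t)).1 = q
  compl_eq : (rsCorrelation n (2 ^ n - t)).1 = r
  neg_compl_eq : (rsCorrelation n (t - 2 ^ n)).1 = -r

theorem isRSTripleAt_zero : IsRSTripleAt 0 0 1 1 0 := by
  constructor <;> simp [rsCorrelation]

/-- The shift t stays in the lower half of the new range. At ±(2^(n+1) - t) only C(t - 2^n)
survives, with opposite signs, which reproduces the antisymmetry. -/
theorem IsRSTripleAt.fold {n : ℕ} {t : ℤ} {p q r : ℝ} (h : IsRSTripleAt n t p q r) :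
    IsRSTripleAt (n + 1) t (p - q + r) (p - q - r) (-r) := by
  obtain ⟨h₀, hle, hp, hq, hr, hr'⟩ := h
  have hpow : (2 : ℤ) ^ (n + 1) = 2 ^ n + 2 ^ n := by ring
  have hpos : (0 : ℤ) < 2 ^ n := by positivity
  have hD := rsCorrelation_snd n t h₀
  have hZ : ∀ s : ℤ, 2 ^ n ≤ s ∨ 2 ^ n ≤ -s → rsCorrelation n s = (0, 0) :=
    fun s hs => rsCorrelation_eq_zero n s (le_abs.2 hs)
  refine ⟨h₀, by omega, ?_, ?_, ?_, ?_⟩ <;> simp only [rsCorrelation]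
  · rw [hD, hp, hq, hr, hZ (2 ^ n + t) (by omega)]
    ring
  · rw [rsCorrelation_snd_neg, hD, hp, hq, sub_neg_eq_add, ← sub_eq_add_neg, hr,
      hZ (2 ^ n + t) (by omega)]
    ring
  · rw [hZ (2 ^ (n + 1) - t) (by omega), hZ (2 ^ n + (2 ^ (n + 1) - t)) (by omega),
      show (2 : ℤ) ^ n - (2 ^ (n + 1) - t) = t - 2 ^ n by omega, hr']
    ring
  · rw [hZ (t - 2 ^ (n + 1)) (by omega), hZ (2 ^ n - (t - 2 ^ (n + 1))) (by omega),
      show (2 : ℤ) ^ n + (t - 2 ^ (n + 1)) = t - 2 ^ n by omega, hr']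
    ring

theorem IsRSTripleAt.flip {n : ℕ} {t : ℤ} {p q r : ℝ} (h : IsRSTripleAt n t p q r) :
    IsRSTripleAt (n + 1) (2 ^ n - t) (p + 2 * r) (2 * r - p) q := by
  obtain ⟨h₀, hle, hp, hq, hr, hr'⟩ := h
  have hpow : (2 : ℤ) ^ (n + 1) = 2 ^ n + 2 ^ n := by ring
  have hpos : (0 : ℤ) < 2 ^ n := by positivity
  have hD := rsCorrelation_snd n (2 ^ n - t) (by omega)
  rw [neg_sub, hr, hr'] at hD
  have hZ : ∀ s : ℤ, 2 ^ n ≤ s ∨ 2 ^ n ≤ -s → rsCorrelation n s = (0, 0) :=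
    fun s hs => rsCorrelation_eq_zero n s (le_abs.2 hs)
  refine ⟨by omega, by omega, ?_, ?_, ?_, ?_⟩ <;> simp only [rsCorrelation]
  · rw [hD, sub_sub_cancel, hp, hZ (2 ^ n + (2 ^ n - t)) (by omega)]
    ring
  · rw [rsCorrelation_snd_neg, hD, hZ (2 ^ n - -(2 ^ n - t)) (by omega),
      show (2 : ℤ) ^ n + -(2 ^ n - t) = t by omega, hp]
    ring
  · rw [hZ (2 ^ (n + 1) - (2 ^ n - t)) (by omega),
      hZ (2 ^ n + (2 ^ (n + 1) - (2 ^ n - t))) (by omega),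
      show (2 : ℤ) ^ n - (2 ^ (n + 1) - (2 ^ n - t)) = -t by omega, hq]
    ring
  · rw [hZ (2 ^ n - t - 2 ^ (n + 1)) (by omega),
      hZ (2 ^ n - (2 ^ n - t - 2 ^ (n + 1))) (by omega),
      show (2 : ℤ) ^ n + (2 ^ n - t - 2 ^ (n + 1)) = -t by omega, hq]
    ring

theorem RSTriple.exists_isRSTripleAt {n : ℕ} {p q r : ℝ} (h : RSTriple n p q r) :
    ∃ t, IsRSTripleAt n t p q r := by
  induction h with
  | zero => exact ⟨0, isRSTripleAt_zero⟩
  | fold _ ih => exact ⟨_, ih.choose_spec.fold⟩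
  | flip _ ih => exact ⟨_, ih.choose_spec.flip⟩

theorem exists_rsTriple (n : ℕ) : ∀ t : ℤ, 0 ≤ t → 2 * t ≤ 2 ^ n →
    ∃ p q r, RSTriple n p q r ∧ IsRSTripleAt n t p q r := by
  induction n with
  | zero =>
    intro t h₀ hle
    obtain rfl : t = 0 := by
      rw [pow_zero] at hle
      omega
    exact ⟨1, 1, 0, .zero, isRSTripleAt_zero⟩
  | succ n ih =>
    intro t h₀ hle
    rw [pow_succ] at hle
    by_cases ht : 2 * t ≤ 2 ^ n
    · obtain ⟨p, q, r, h, h'⟩ := ih t h₀ ht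
      exact ⟨_, _, _, h.fold, h'.fold⟩
    · obtain ⟨p, q, r, h, h'⟩ := ih (2 ^ n - t) (by omega) (by omega)
      exact ⟨_, _, _, h.flip, by simpa using h'.flip⟩

/-- Bounds on all triples of level `n` bound the peak crosscorrelation. -/
theorem peakCrosscorrelation_le {n : ℕ} {B : ℝ}
    (h : ∀ p q r, RSTriple n p q r → |p| ≤ B ∧ |q| ≤ B ∧ |r| ≤ B) :
    peakCrosscorrelation (rudinShapiro n) (rudinShapiroCompanion n) ≤ B := by
  have hB : 0 ≤ B := by
    obtain ⟨p, q, r, hT, -⟩ := exists_rsTriple n 0 le_rfl (by positivity)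
    exact (abs_nonneg p).trans (h p q r hT).1
  refine ciSup_le fun s => ?_
  rw [crosscorrelation_rudinShapiro, Complex.norm_real, Real.norm_eq_abs]
  by_cases hs : 2 ^ n ≤ |s|
  · simpa [rsCorrelation_eq_zero n s hs] using hB
  rw [le_abs, not_or, not_le, not_le] at hs
  have key : ∀ t : ℤ, 0 ≤ t → 2 * t ≤ 2 ^ n →
      ∀ u, (u = t ∨ u = -t ∨ u = 2 ^ n - t ∨ u = t - 2 ^ n) → |(rsCorrelation n u).1| ≤ B := by
    intro t h₀ hle u hu
    obtain ⟨p, q, r, hT, hA⟩ := exists_rsTriple n t h₀ hle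
    obtain ⟨hp, hq, hr⟩ := h p q r hT
    rcases hu with rfl | rfl | rfl | rfl
    · rwa [hA.pos_eq]
    · rwa [hA.neg_eq]
    · rwa [hA.compl_eq]
    · rwa [hA.neg_compl_eq, abs_neg]
  -- Every shift inside the support is ±t or ±(2^n - t), with t the smaller of |s| and 2^n - |s|.
  by_cases h₁ : 2 * |s| ≤ 2 ^ n
  · exact key |s| (abs_nonneg s) h₁ s (by rcases abs_cases s with h | h <;> omega)
  · exact key (2 ^ n - |s|) (by rcases abs_cases s with h | h <;> omega) (by omega) s
      (by rcases abs_cases s with h | h <;> omega)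

theorem abs_le_peakCrosscorrelation (n : ℕ) (s : ℤ) :
    |(rsCorrelation n s).1| ≤ peakCrosscorrelation (rudinShapiro n) (rudinShapiroCompanion n) := by
  have := (isGreatest_peakCrosscorrelation (rudinShapiro n) (rudinShapiroCompanion n)).2
    (Set.mem_range_self s)
  simpa [crosscorrelation_rudinShapiro] using this

theorem RSTriple.abs_snd_le {n : ℕ} {p q r : ℝ} (h : RSTriple n p q r) :
    |q| ≤ peakCrosscorrelation (rudinShapiro n) (rudinShapiroCompanion n) := by
  obtain ⟨t, ht⟩ := h.exists_isRSTripleAt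
  rw [← ht.neg_eq]
  exact abs_le_peakCrosscorrelation n _

/-! ### An invariant polytope

`PeakBound α A` describes a symmetric polytope, scaled by `A`, which `fold` and `flip` map into its
multiple by `α`. The functional in `eig` is an eigenvector of `flip` for the eigenvalue `-α`, and
`bound_a_b_c` bounds `a * p + b * q + c * r`, where `m` marks a negative coefficient. -/
structure PeakBound (α A p q r : ℝ) : Prop where
  eig : |p + (1 + α) * q - α * (1 + α) * r| ≤ 4 * A
  bound_1_0_0 : |p| ≤ 1.07 * A
  bound_0_1_0 : |q| ≤ 1.07 * A
  bound_0_0_1 : |r| ≤ 1.07 * A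
  bound_1_m1_1 : |p - q + r| ≤ 1.77 * A
  bound_1_0_2 : |p + 2 * r| ≤ 1.77 * A
  bound_m1_0_2 : |-p + 2 * r| ≤ 1.77 * A
  bound_2_1_0 : |2 * p + q| ≤ 2.93 * A
  bound_1_2_2 : |p + 2 * q + 2 * r| ≤ 2.93 * A
  bound_m1_1_m3 : |-p + q - 3 * r| ≤ 2.93 * A
  bound_m1_2_m2 : |-p + 2 * q - 2 * r| ≤ 2.93 * A
  bound_1_0_6 : |p + 6 * r| ≤ 4.86 * A
  bound_1_m1_m1 : |p - q - r| ≤ 1.62 * A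
  bound_m1_2_6 : |-p + 2 * q + 6 * r| ≤ 4.86 * A
  bound_m2_m3_0 : |-2 * p - 3 * q| ≤ 4.86 * A
  bound_m3_m2_2 : |-3 * p - 2 * q + 2 * r| ≤ 4.86 * A
  bound_m5_5_1 : |-5 * p + 5 * q + r| ≤ 8.06 * A
  bound_1_0_m10 : |p - 10 * r| ≤ 8.06 * A
  bound_m5_5_m3 : |-5 * p + 5 * q - 3 * r| ≤ 8.06 * A
  bound_m1_2_m10 : |-p + 2 * q - 10 * r| ≤ 8.06 * A

namespace PeakBound

variable {α A p q r : ℝ}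

theorem approx_eig (h : PeakBound α A p q r) (hα : 1.658967 ≤ α) (hα' : α ≤ 1.658968) :
    |p + 2.658967 * q - 4.411138 * r| ≤ 4.00001 * A := by
  have hA : 0 ≤ A := by linarith [(abs_nonneg _).trans h.bound_0_1_0]
  have hq : |(α - 1.658967) * q| ≤ 0.000001 * (1.07 * A) := by
    rw [abs_mul]
    refine mul_le_mul ?_ h.bound_0_1_0 (abs_nonneg _) (by norm_num)
    rw [abs_le]; constructor <;> linarith
  have hr : |(α * (1 + α) - 4.411138) * r| ≤ 0.000005 * (1.07 * A) := by
    rw [abs_mul]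
    refine mul_le_mul ?_ h.bound_0_0_1 (abs_nonneg _) (by norm_num)
    rw [abs_le]; constructor <;> nlinarith
  have h₁ := abs_le.1 h.eig
  have h₂ := abs_le.1 hq
  have h₃ := abs_le.1 hr
  rw [abs_le]; constructor <;> linarith

theorem eig_fold (h : PeakBound α A p q r) (hα : 1.658967 ≤ α) (hα' : α ≤ 1.658968) :
    |(p - q + r) + (1 + α) * (p - q - r) - α * (1 + α) * -r| ≤ 4 * (α * A) := by
  have hA : 0 ≤ A := by linarith [(abs_nonneg _).trans h.bound_0_1_0]
  have hp : |(α - 1.658967) * (p - q + r)| ≤ 0.000001 * (1.77 * A) := by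
    rw [abs_mul]
    refine mul_le_mul ?_ h.bound_1_m1_1 (abs_nonneg _) (by norm_num)
    rw [abs_le]; constructor <;> linarith
  have hr : |(α * α - α - 1.093205) * r| ≤ 0.00001 * (1.07 * A) := by
    rw [abs_mul]
    refine mul_le_mul ?_ h.bound_0_0_1 (abs_nonneg _) (by norm_num)
    rw [abs_le]; constructor <;> nlinarith
  have hαA : 1.658967 * A ≤ α * A := mul_le_mul_of_nonneg_right hα hA
  have h₁ := abs_le.1 h.bound_1_m1_1
  have h₂ := abs_le.1 h.bound_m5_5_m3
  have h₃ := abs_le.1 hp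
  have h₄ := abs_le.1 hr
  rw [abs_le]; constructor <;> linarith

/-- This face is scaled by exactly α, so it needs the exact root; the other faces leave slack for
decimal estimates. -/
theorem eig_flip (h : PeakBound α A p q r) (hα : 0 ≤ α)
    (hroot : α ^ 3 + α ^ 2 - 2 * α - 4 = 0) :
    |(p + 2 * r) + (1 + α) * (2 * r - p) - α * (1 + α) * q| ≤ 4 * (α * A) := by
  rw [show (p + 2 * r) + (1 + α) * (2 * r - p) - α * (1 + α) * q
      = -(α * (p + (1 + α) * q - α * (1 + α) * r)) by linear_combination -r * hroot,
    abs_neg, abs_mul, abs_of_nonneg hα, mul_left_comm]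
  exact mul_le_mul_of_nonneg_left h.eig hα

/-- Pulling a face back along either map gives a listed face or a combination of listed ones. The
bounds 1.07, 1.77, 2.93, 4.86, 8.06 are successive multiples by α, rounded down; 1.62 is a tighter
exception. -/
theorem fold (h : PeakBound α A p q r) (hα : 1.658967 ≤ α) (hα' : α ≤ 1.658968) :
    PeakBound α (α * A) (p - q + r) (p - q - r) (-r) := by
  have hA : 0 ≤ A := by linarith [(abs_nonneg _).trans h.bound_0_1_0]
  have hαA : 1.658967 * A ≤ α * A := mul_le_mul_of_nonneg_right hα hA
  have h3 := abs_le.1 h.bound_0_0_1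
  have h4 := abs_le.1 h.bound_1_m1_1
  have h5 := abs_le.1 h.bound_1_0_2
  have h6 := abs_le.1 h.bound_m1_0_2
  have h9 := abs_le.1 h.bound_m1_1_m3
  have h11 := abs_le.1 h.bound_1_0_6
  have h12 := abs_le.1 h.bound_1_m1_m1
  have h13 := abs_le.1 h.bound_m1_2_6
  have h16 := abs_le.1 h.bound_m5_5_1
  have h17 := abs_le.1 h.bound_1_0_m10
  have h18 := abs_le.1 h.bound_m5_5_m3
  have h19 := abs_le.1 h.bound_m1_2_m10
  constructor
  · exact h.eig_fold hα hα'
  · rw [abs_le]; constructor <;> linarith only [hαA, hA, h4]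
  · rw [abs_le]; constructor <;> linarith only [hαA, hA, h12]
  · rw [abs_le]; constructor <;> linarith only [hαA, hA, h3]
  · rw [abs_le]; constructor <;> linarith only [hαA, hA, h3]
  · rw [abs_le]; constructor <;> linarith only [hαA, hA, h12]
  · rw [abs_le]; constructor <;> linarith only [hαA, hA, h9]
  · rw [abs_le]; constructor <;> linarith only [hαA, hA, h16, h18]
  · rw [abs_le]; constructor <;> linarith only [hαA, hA, h12]
  · rw [abs_le]; constructor <;> linarith only [hαA, hA, h3]
  · rw [abs_le]; constructor <;> linarith only [hαA, hA, h12]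
  · rw [abs_le]; constructor <;> linarith only [hαA, hA, h6, h13, h17]
  · rw [abs_le]; constructor <;> linarith only [hαA, hA, h13, h19]
  · rw [abs_le]; constructor <;> linarith only [hαA, hA, h11, h13, h17]
  · rw [abs_le]; constructor <;> linarith only [hαA, hA, h16]
  · rw [abs_le]; constructor <;> linarith only [hαA, hA, h18]
  · rw [abs_le]; constructor <;> linarith only [hαA, hA, h3]
  · rw [abs_le]; constructor <;> linarith only [hαA, hA, h11, h13, h19]
  · rw [abs_le]; constructor <;> linarith only [hαA, hA, h3]
  · rw [abs_le]; constructor <;> linarith only [hαA, hA, h5, h11, h19]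

theorem flip (h : PeakBound α A p q r) (hα : 1.658967 ≤ α) (hα' : α ≤ 1.658968)
    (hroot : α ^ 3 + α ^ 2 - 2 * α - 4 = 0) :
    PeakBound α (α * A) (p + 2 * r) (2 * r - p) q := by
  have hA : 0 ≤ A := by linarith [(abs_nonneg _).trans h.bound_0_1_0]
  have hαA : 1.658967 * A ≤ α * A := mul_le_mul_of_nonneg_right hα hA
  have h0 := abs_le.1 (h.approx_eig hα hα')
  have h1 := abs_le.1 h.bound_1_0_0
  have h2 := abs_le.1 h.bound_0_1_0
  have h5 := abs_le.1 h.bound_1_0_2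
  have h6 := abs_le.1 h.bound_m1_0_2
  have h7 := abs_le.1 h.bound_2_1_0
  have h8 := abs_le.1 h.bound_1_2_2
  have h10 := abs_le.1 h.bound_m1_2_m2
  have h11 := abs_le.1 h.bound_1_0_6
  have h12 := abs_le.1 h.bound_1_m1_m1
  have h13 := abs_le.1 h.bound_m1_2_6
  have h14 := abs_le.1 h.bound_m2_m3_0
  have h15 := abs_le.1 h.bound_m3_m2_2
  have h16 := abs_le.1 h.bound_m5_5_1
  have h17 := abs_le.1 h.bound_1_0_m10
  have h18 := abs_le.1 h.bound_m5_5_m3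
  have h19 := abs_le.1 h.bound_m1_2_m10
  constructor
  · exact h.eig_flip (by linarith) hroot
  · rw [abs_le]; constructor <;> linarith only [hαA, hA, h5]
  · rw [abs_le]; constructor <;> linarith only [hαA, hA, h6]
  · rw [abs_le]; constructor <;> linarith only [hαA, hA, h2]
  · rw [abs_le]; constructor <;> linarith only [hαA, hA, h7]
  · rw [abs_le]; constructor <;> linarith only [hαA, hA, h8]
  · rw [abs_le]; constructor <;> linarith only [hαA, hA, h10]
  · rw [abs_le]; constructor <;> linarith only [hαA, hA, h11]
  · rw [abs_le]; constructor <;> linarith only [hαA, hA, h13]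
  · rw [abs_le]; constructor <;> linarith only [hαA, hA, h14]
  · rw [abs_le]; constructor <;> linarith only [hαA, hA, h15]
  · rw [abs_le]; constructor <;> linarith only [hαA, hA, h2, h8]
  · rw [abs_le]; constructor <;> linarith only [hαA, hA, h1, h16, h18]
  · rw [abs_le]; constructor <;> linarith only [hαA, hA, h2, h12, h16]
  · rw [abs_le]; constructor <;> linarith only [hαA, hA, h17]
  · rw [abs_le]; constructor <;> linarith only [hαA, hA, h19]
  · rw [abs_le]; constructor <;> linarith only [hαA, hA, h1, h16, h18]
  · rw [abs_le]; constructor <;> linarith only [hαA, hA, h2, h10]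
  · rw [abs_le]; constructor <;> linarith only [hαA, hA, h1, h7]
  -- Only here does the eigenvector face enter another face's estimate, closing the list of
  -- functionals.
  · rw [abs_le]; constructor <;> linarith only [hαA, hA, h0, h2, h14]

end PeakBound

/-! ### The growth rate -/

theorem exists_rudinShapiro_rate :
    ∃ α : ℝ, 1.658967081 ≤ α ∧ α ≤ 1.658967082 ∧ α ^ 3 + α ^ 2 - 2 * α - 4 = 0 := by
  have hcont : ContinuousOn (fun x : ℝ => x ^ 3 + x ^ 2 - 2 * x - 4)
      (Set.Icc 1.658967081 1.658967082) := by fun_prop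
  obtain ⟨α, hα, h⟩ := intermediate_value_Icc (by norm_num) hcont
    (show (0 : ℝ) ∈ Set.Icc _ _ by constructor <;> norm_num)
  exact ⟨α, hα.1, hα.2, h⟩

theorem eq_rudinShapiro_rate {α a : ℝ} (hα : 1.658967 ≤ α)
    (hroot : α ^ 3 + α ^ 2 - 2 * α - 4 = 0) (ha : a ^ 3 + a ^ 2 - 2 * a - 4 = 0) : a = α := by
  have h : (a - α) * (a ^ 2 + (1 + α) * a + (α ^ 2 + α - 2)) = 0 := by
    linear_combination ha - hroot
  rcases mul_eq_zero.1 h with h | h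
  · linarith
  -- The quadratic cofactor has discriminant 9 - 2α - 3α², which is negative.
  · nlinarith [sq_nonneg (a + (1 + α) / 2)]

/-! ### The upper bound -/

theorem RSTriple.one {p q r : ℝ} (h : RSTriple 1 p q r) :
    (p = 0 ∧ q = 0 ∧ r = 0) ∨ (p = 1 ∧ q = -1 ∧ r = 1) := by
  cases h with
  | fold h => cases h; norm_num
  | flip h => cases h; norm_num

theorem RSTriple.two {p q r : ℝ} (h : RSTriple 2 p q r) :
    (p = 0 ∧ q = 0 ∧ r = 0) ∨ (p = 3 ∧ q = 1 ∧ r = -1) := by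
  cases h with
  | fold h => rcases h.one with ⟨rfl, rfl, rfl⟩ | ⟨rfl, rfl, rfl⟩ <;> norm_num
  | flip h => rcases h.one with ⟨rfl, rfl, rfl⟩ | ⟨rfl, rfl, rfl⟩ <;> norm_num

theorem RSTriple.three {p q r : ℝ} (h : RSTriple 3 p q r) :
    (p = 0 ∧ q = 0 ∧ r = 0) ∨ (p = 1 ∧ q = 3 ∧ r = 1) ∨ (p = 1 ∧ q = -5 ∧ r = 1) := by
  cases h with
  | fold h => rcases h.two with ⟨rfl, rfl, rfl⟩ | ⟨rfl, rfl, rfl⟩ <;> norm_num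
  | flip h => rcases h.two with ⟨rfl, rfl, rfl⟩ | ⟨rfl, rfl, rfl⟩ <;> norm_num

theorem RSTriple.four {p q r : ℝ} (h : RSTriple 4 p q r) :
    (p = 0 ∧ q = 0 ∧ r = 0) ∨ (p = -1 ∧ q = -3 ∧ r = -1) ∨ (p = 3 ∧ q = 1 ∧ r = 3) ∨
      (p = 7 ∧ q = 5 ∧ r = -1) ∨ (p = 3 ∧ q = 1 ∧ r = -5) := by
  cases h with
  | fold h =>
    rcases h.three with ⟨rfl, rfl, rfl⟩ | ⟨rfl, rfl, rfl⟩ | ⟨rfl, rfl, rfl⟩ <;> norm_num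
  | flip h =>
    rcases h.three with ⟨rfl, rfl, rfl⟩ | ⟨rfl, rfl, rfl⟩ | ⟨rfl, rfl, rfl⟩ <;> norm_num

/-- Level 3 would be too early: its entry -5 exceeds 1.07 α³ in absolute value. -/
theorem RSTriple.peakBound_four {α p q r : ℝ} (hα : 1.658967 ≤ α) (hα' : α ≤ 1.658968)
    (h : RSTriple 4 p q r) : PeakBound α (α ^ 4) p q r := by
  have h₂ : 2.75217 ≤ α ^ 2 := by nlinarith
  have h₂' : α ^ 2 ≤ 2.75218 := by nlinarith
  have h₄ : 7.574 ≤ α ^ 4 := by nlinarith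
  rcases h.four with ⟨rfl, rfl, rfl⟩ | ⟨rfl, rfl, rfl⟩ | ⟨rfl, rfl, rfl⟩ | ⟨rfl, rfl, rfl⟩ |
    ⟨rfl, rfl, rfl⟩
  all_goals
    constructor
    · rw [abs_le]; constructor <;> linarith
    all_goals rw [abs_le]; constructor <;> linarith only [h₄]

theorem RSTriple.peakBound {α : ℝ} (hα : 1.658967 ≤ α) (hα' : α ≤ 1.658968)
    (hroot : α ^ 3 + α ^ 2 - 2 * α - 4 = 0) {n : ℕ} (hn : 4 ≤ n) :
    ∀ {p q r : ℝ}, RSTriple n p q r → PeakBound α (α ^ n) p q r := by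
  induction n, hn using Nat.le_induction with
  | base => exact fun h => h.peakBound_four hα hα'
  | succ n _ ih =>
    intro p q r h
    rw [pow_succ']
    cases h with
    | fold h => exact (ih h).fold hα hα'
    | flip h => exact (ih h).flip hα hα' hroot

theorem peakCrosscorrelation_rudinShapiro_three :
    peakCrosscorrelation (rudinShapiro 3) (rudinShapiroCompanion 3) = 5 := by
  refine le_antisymm (peakCrosscorrelation_le fun p q r h => ?_) ?_
  · rcases h.three with ⟨rfl, rfl, rfl⟩ | ⟨rfl, rfl, rfl⟩ | ⟨rfl, rfl, rfl⟩ <;> norm_num [abs_le]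
  -- Three flips take (1, 1, 0) to (1, -5, 1).
  · have h := RSTriple.zero.flip.flip.flip.abs_snd_le
    norm_num at h
    exact h

theorem peakCrosscorrelation_rudinShapiro_lt {α : ℝ} (hα : 1.658967 ≤ α) (hα' : α ≤ 1.658968)
    (hroot : α ^ 3 + α ^ 2 - 2 * α - 4 = 0) {n : ℕ} (hn : n ≠ 3) :
    peakCrosscorrelation (rudinShapiro n) (rudinShapiroCompanion n) < 5 * α ^ ((n : ℤ) - 3) := by
  have hα₀ : 0 < α := by linarith
  have h₂ : 2.7521 ≤ α ^ 2 := by nlinarith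
  have h₃ : α ^ 3 ≤ 4.57 := by nlinarith
  have h₃₀ : 0 < α ^ 3 := by positivity
  have hzpow : 5 * α ^ ((n : ℤ) - 3) = 5 * α ^ n / α ^ 3 := by
    rw [zpow_sub₀ hα₀.ne', zpow_natCast, mul_div_assoc]
    norm_cast
  rw [hzpow, lt_div_iff₀ h₃₀]
  rcases Nat.lt_or_ge n 4 with h | h
  · interval_cases n
    · have : peakCrosscorrelation (rudinShapiro 0) (rudinShapiroCompanion 0) ≤ 1 :=
        peakCrosscorrelation_le fun p q r h => by cases h; norm_num
      nlinarith
    · have : peakCrosscorrelation (rudinShapiro 1) (rudinShapiroCompanion 1) ≤ 1 :=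
        peakCrosscorrelation_le fun p q r h => by
          rcases h.one with ⟨rfl, rfl, rfl⟩ | ⟨rfl, rfl, rfl⟩ <;> norm_num
      nlinarith
    · have : peakCrosscorrelation (rudinShapiro 2) (rudinShapiroCompanion 2) ≤ 3 :=
        peakCrosscorrelation_le fun p q r h => by
          rcases h.two with ⟨rfl, rfl, rfl⟩ | ⟨rfl, rfl, rfl⟩ <;> norm_num [abs_le]
      nlinarith
    · exact absurd rfl hn
  -- Strictness comes from 1.07 < 5 / α³.
  · have hle : peakCrosscorrelation (rudinShapiro n) (rudinShapiroCompanion n) ≤ 1.07 * α ^ n :=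
      peakCrosscorrelation_le fun p q r hT =>
        have hB := hT.peakBound hα hα' hroot h
        ⟨hB.bound_1_0_0, hB.bound_0_1_0, hB.bound_0_0_1⟩
    have hpow : 0 < α ^ n := by positivity
    nlinarith

/-! ### The lower bound -/

/-- The triple obtained from `(1, 1, 0)` by applying `flip` `n` times. -/
def flipOrbit : ℕ → ℝ × ℝ × ℝ
  | 0 => (1, 1, 0)
  | n + 1 =>
    let v := flipOrbit n
    (v.1 + 2 * v.2.2, 2 * v.2.2 - v.1, v.2.1)

theorem rsTriple_flipOrbit (n : ℕ) :
    RSTriple n (flipOrbit n).1 (flipOrbit n).2.1 (flipOrbit n).2.2 := by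
  induction n with
  | zero => exact .zero
  | succ n ih => exact ih.flip

/-- The deviation of `(-1)^n C(-t_n)` from its main term `c * α^n`, along the orbit of `flip`. -/
def flipDeviation (α c : ℝ) (n : ℕ) : ℝ := (-1) ^ n * (flipOrbit n).2.1 - c * α ^ n

/-- The signed orbit obeys the cubic recurrence. Dividing out X - α, the defect in the quadratic
recurrence is multiplied by α at each step, and the constant c is the one making it vanish
initially. -/
theorem flipDeviation_add_two {α : ℝ} (hroot : α ^ 3 + α ^ 2 - 2 * α - 4 = 0) (n : ℕ) :
    flipDeviation α ((9 * α ^ 2 + 4 * α + 6) / 59) (n + 2) =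
      -(1 + α) * flipDeviation α ((9 * α ^ 2 + 4 * α + 6) / 59) (n + 1)
        - (α ^ 2 + α - 2) * flipDeviation α ((9 * α ^ 2 + 4 * α + 6) / 59) n := by
  induction n with
  | zero =>
    norm_num [flipDeviation, flipOrbit]
    linear_combination -(27 * α + 3) / 59 * hroot
  | succ n ih =>
    simp only [flipDeviation, flipOrbit, pow_succ] at ih ⊢
    linear_combination α * ih - ((-1) ^ n * (flipOrbit n).2.1) * hroot

/-- For a recurrence with roots β and its conjugate, the form (e' - βe)(e' - β̄e) in consecutive
terms e, e' gains the factor |β|² = α² + α - 2 at each step. -/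
theorem flipDeviation_form {α : ℝ} (hroot : α ^ 3 + α ^ 2 - 2 * α - 4 = 0) (n : ℕ) :
    flipDeviation α ((9 * α ^ 2 + 4 * α + 6) / 59) (n + 1) ^ 2
      + (1 + α) * flipDeviation α ((9 * α ^ 2 + 4 * α + 6) / 59) n
        * flipDeviation α ((9 * α ^ 2 + 4 * α + 6) / 59) (n + 1)
      + (α ^ 2 + α - 2) * flipDeviation α ((9 * α ^ 2 + 4 * α + 6) / 59) n ^ 2
      = (α ^ 2 + α - 2) ^ n * ((-4 * α ^ 2 + 2 * α + 14) / 59 * (3 * α ^ 2 + 2 * α - 9)) := by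
  induction n with
  | zero =>
    norm_num [flipDeviation, flipOrbit]
    linear_combination (243 * α ^ 3 + 135 * α ^ 2 - 180 * α - 2106) / 3481 * hroot
  | succ n ih =>
    rw [flipDeviation_add_two hroot, pow_succ]
    linear_combination (α ^ 2 + α - 2) * ih

theorem abs_flipDeviation_le {α : ℝ} (hα : 1.658967 ≤ α)
    (hroot : α ^ 3 + α ^ 2 - 2 * α - 4 = 0) (n : ℕ) :
    |flipDeviation α ((9 * α ^ 2 + 4 * α + 6) / 59) n| ≤
      2 * Real.sqrt ((-4 * α ^ 2 + 2 * α + 14) / 59) * Real.sqrt ((α ^ 2 - 1) / 2) ^ n * α ^ n := by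
  have hform := flipDeviation_form hroot n
  set e := flipDeviation α ((9 * α ^ 2 + 4 * α + 6) / 59)
  have hα' : α ≤ 1.658968 := by nlinarith
  have hα₀ : 0 ≤ α := by linarith
  have hT : 0 ≤ (-4 * α ^ 2 + 2 * α + 14) / 59 := by nlinarith
  have hρ : 0 ≤ (α ^ 2 - 1) / 2 := by nlinarith
  have hdisc : 0 < 3 * α ^ 2 + 2 * α - 9 := by nlinarith
  have hβ : α ^ 2 + α - 2 = (α ^ 2 - 1) / 2 * α ^ 2 := by
    linear_combination -(α - 1) / 2 * hroot
  refine abs_le_of_sq_le_sq ?_ (by positivity)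
  have hrhs : (2 * Real.sqrt ((-4 * α ^ 2 + 2 * α + 14) / 59)
      * Real.sqrt ((α ^ 2 - 1) / 2) ^ n * α ^ n) ^ 2
      = (α ^ 2 + α - 2) ^ n * (4 * ((-4 * α ^ 2 + 2 * α + 14) / 59)) := by
    rw [hβ, mul_pow, mul_pow, mul_pow, Real.sq_sqrt hT, ← pow_mul, mul_comm n 2, pow_mul,
      Real.sq_sqrt hρ, mul_pow, ← pow_mul α, ← pow_mul α, mul_comm n 2]
    ring
  rw [hrhs]
  refine le_of_mul_le_mul_right ?_ hdisc
  -- Completing the square: four times the form is this square plus (3α² + 2α - 9) e_n².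
  have := sq_nonneg (2 * e (n + 1) + (1 + α) * e n)
  linear_combination this + 4 * hform

theorem le_peakCrosscorrelation_rudinShapiro {α : ℝ} (hα : 1.658967 ≤ α)
    (hroot : α ^ 3 + α ^ 2 - 2 * α - 4 = 0) (n : ℕ) :
    ((9 * α ^ 2 + 4 * α + 6) / 59
        - 2 * Real.sqrt ((-4 * α ^ 2 + 2 * α + 14) / 59)
          * Real.sqrt ((α ^ 2 - 1) / 2) ^ n) * α ^ n
      ≤ peakCrosscorrelation (rudinShapiro n) (rudinShapiroCompanion n) := by
  have h₁ := (rsTriple_flipOrbit n).abs_snd_le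
  have h₂ := (abs_le.1 (abs_flipDeviation_le hα hroot n)).1
  have h₃ : (-1) ^ n * (flipOrbit n).2.1 ≤ |(flipOrbit n).2.1| := by
    refine (le_abs_self _).trans_eq ?_
    rw [abs_mul, abs_pow, abs_neg, abs_one, one_pow, one_mul]
  unfold flipDeviation at h₂
  linarith

theorem theorem1p3 :
    ∃ α₀ : ℝ,
      -- `α₀` is the unique real root of the cubic, and `α₀ = 1.658967…`
      (∀ a : ℝ, (X ^ 3 + X ^ 2 - 2 * X - 4 : ℝ[X]).IsRoot a ↔ a = α₀) ∧
      (1.658967 ≤ α₀ ∧ α₀ < 1.658968) ∧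
      -- the decimal values of the constants
      (1.095107 ≤ 5 * α₀ ^ (-3 : ℤ) ∧ 5 * α₀ ^ (-3 : ℤ) < 1.095108) ∧
      (0.633990 ≤ (9 * α₀ ^ 2 + 4 * α₀ + 6) / 59 ∧
        (9 * α₀ ^ 2 + 4 * α₀ + 6) / 59 < 0.633991) ∧
      (0.654022 ≤ 2 * Real.sqrt ((-4 * α₀ ^ 2 + 2 * α₀ + 14) / 59) ∧
        2 * Real.sqrt ((-4 * α₀ ^ 2 + 2 * α₀ + 14) / 59) < 0.654023) ∧
      (0.935994 ≤ Real.sqrt ((α₀ ^ 2 - 1) / 2) ∧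
        Real.sqrt ((α₀ ^ 2 - 1) / 2) < 0.935995) ∧
      ∀ n : ℕ,
        -- the upper bound, and exactly when it is attained
        peakCrosscorrelation (rudinShapiro n) (rudinShapiroCompanion n)
          ≤ 5 * α₀ ^ ((n : ℤ) - 3) ∧
        (peakCrosscorrelation (rudinShapiro n) (rudinShapiroCompanion n)
          = 5 * α₀ ^ ((n : ℤ) - 3) ↔ n = 3) ∧
        -- the lower bound
        ((9 * α₀ ^ 2 + 4 * α₀ + 6) / 59
            - 2 * Real.sqrt ((-4 * α₀ ^ 2 + 2 * α₀ + 14) / 59)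
              * Real.sqrt ((α₀ ^ 2 - 1) / 2) ^ n) * α₀ ^ n
          ≤ peakCrosscorrelation (rudinShapiro n) (rudinShapiroCompanion n) := by
  obtain ⟨α, hl, hu, hroot⟩ := exists_rudinShapiro_rate
  have hα : 1.658967 ≤ α := by linarith
  have hα' : α ≤ 1.658968 := by linarith
  have hα₀ : 0 < α := by linarith
  have hsql : 2.752171776 ≤ α ^ 2 := by nlinarith
  have hsqu : α ^ 2 ≤ 2.752171781 := by nlinarith
  have hcube : α ^ 3 = 4 + 2 * α - α ^ 2 := by linarith
  have hzpow : α ^ (-3 : ℤ) = (α ^ 3)⁻¹ := by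
    rw [zpow_neg]
    norm_cast
  have hthree : peakCrosscorrelation (rudinShapiro 3) (rudinShapiroCompanion 3)
      = 5 * α ^ (((3 : ℕ) : ℤ) - 3) := by
    simp [peakCrosscorrelation_rudinShapiro_three]
  refine ⟨α, fun a => ?_, ⟨hα, by linarith⟩, ?_, ⟨by linarith, by linarith⟩, ?_, ?_, fun n =>
    ⟨?_, ?_, le_peakCrosscorrelation_rudinShapiro hα hroot n⟩⟩
  · have heval : (X ^ 3 + X ^ 2 - 2 * X - 4 : ℝ[X]).eval a = a ^ 3 + a ^ 2 - 2 * a - 4 := by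
      simp
    rw [IsRoot.def, heval]
    exact ⟨eq_rudinShapiro_rate hα hroot, fun h => h ▸ hroot⟩
  · have hpos : 0 < α ^ 3 := by positivity
    rw [hzpow, ← div_eq_mul_inv, le_div_iff₀ hpos, div_lt_iff₀ hpos, hcube]
    constructor <;> linarith
  · constructor
    · have : 0.327011 ≤ Real.sqrt ((-4 * α ^ 2 + 2 * α + 14) / 59) :=
        Real.le_sqrt_of_sq_le (by linarith)
      linarith
    · have : Real.sqrt ((-4 * α ^ 2 + 2 * α + 14) / 59) < 0.3270115 :=
        (Real.sqrt_lt' (by norm_num)).2 (by linarith)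
      linarith
  · exact ⟨Real.le_sqrt_of_sq_le (by linarith),
      (Real.sqrt_lt' (by norm_num)).2 (by linarith)⟩
  · by_cases hn : n = 3
    · rw [hn, hthree]
    · exact (peakCrosscorrelation_rudinShapiro_lt hα hα' hroot hn).le
  · refine ⟨fun h => ?_, fun hn => hn ▸ hthree⟩
    by_contra hn
    exact (peakCrosscorrelation_rudinShapiro_lt hα hα' hroot hn).ne h
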